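/- Let $\mathbb{T}=\mathbb{R}/\mathbb{Z}$ and write $|t|$ for the distance of $t\in\mathbb{T}$ to $0$ (for a real representative, the distance to the nearest integer). A sequence $(y_n)_{n\ge 1}$ in $\mathbb{T}$ has Poissonian pair correlation if for every $s>0$ $$\lim_{N\to\infty}\frac1N\,\#\Big\{1\le m\ne n\le N:\ |y_m-y_n|\le \frac sN\Big\}=2s,$$ and it has Poissonian correlation of four-fold differences if for every $s>0$ $$\lim_{N\to\infty}\frac1{N^2}\,\#\Big\{1\le m,n,k,l\le N,\ \{m,n\}\ne\{k,l\}:\ |y_m+y_n-y_k-y_l|\le \frac s{N^2}\Big\}=2s.$$ Let $x_1,x_3,x_5,\ldots$ be uniformly distributed on $\mathbb{T}$, put $x_{2j}=x_{2j-1}$ for all $j\ge 1$, and for each $n\ge 1$ let $p_n$ be uniformly distributed on the interval $[-n^{-3/2},n^{-3/2}]$, where all the random variables $x_1,x_3,x_5,\ldots,p_1,p_2,p_3,\ldots$ are mutually independent. Define $y_n=x_n+p_n \pmod 1$ for $n\ge 1$. Then, almost surely, $(y_n)$ does not have Poissonian pair correlation, but does have Poissonian correlation of four-fold differences. -/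

import Mathlib

/-- The number of ordered pairs `(m, n)` with `1 ≤ m, n ≤ N`, `m ≠ n` and `|x m - x n| ≤ r`.
The norm on `UnitAddCircle = ℝ / ℤ` is the distance to the nearest integer. -/
noncomputable def pairCount (x : ℕ → UnitAddCircle) (N : ℕ) (r : ℝ) : ℕ :=
  ((Finset.Icc 1 N ×ˢ Finset.Icc 1 N).filter
    (fun q : ℕ × ℕ => q.1 ≠ q.2 ∧ ‖x q.1 - x q.2‖ ≤ r)).card

/-- The number of quadruples `(m, n, k, l)` with `1 ≤ m, n, k, l ≤ N`, `{m, n} ≠ {k, l}` and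
`|x m + x n - x k - x l| ≤ r`. -/
noncomputable def fourFoldCount (x : ℕ → UnitAddCircle) (N : ℕ) (r : ℝ) : ℕ :=
  ((Finset.Icc 1 N ×ˢ Finset.Icc 1 N ×ˢ Finset.Icc 1 N ×ˢ Finset.Icc 1 N).filter
    (fun q : ℕ × ℕ × ℕ × ℕ =>
      ({q.1, q.2.1} : Finset ℕ) ≠ {q.2.2.1, q.2.2.2} ∧
        ‖x q.1 + x q.2.1 - x q.2.2.1 - x q.2.2.2‖ ≤ r)).card

/-- Poissonian pair correlation of the sequence `x 1, x 2, …` (the value `x 0` plays no role). -/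
def PoissonianPairCorrelation (x : ℕ → UnitAddCircle) : Prop :=
  ∀ s : ℝ, 0 < s →
    Filter.Tendsto (fun N : ℕ => (pairCount x N (s / (N : ℝ)) : ℝ) / (N : ℝ))
      Filter.atTop (nhds (2 * s))

/-- Poissonian correlation of four-fold differences of the sequence `x 1, x 2, …`
(the value `x 0` plays no role). -/
def PoissonianFourFoldCorrelation (x : ℕ → UnitAddCircle) : Prop :=
  ∀ s : ℝ, 0 < s →
    Filter.Tendsto (fun N : ℕ => (fourFoldCount x N (s / (N : ℝ) ^ 2) : ℝ) / (N : ℝ) ^ 2)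
      Filter.atTop (nhds (2 * s))

/-! With indices shifted to start at 0, the points in block `{2b, 2b+1}` share one uniform variable
and differ only in their perturbations. Every four-fold difference is then an integer combination of
independent circle variables: `Sum.inl b` for the uniform ones, `Sum.inr i` for the perturbations.

Pair correlation fails because the two points of a block near index `n` are `O(n^(-3/2)) = o(1/n)`
apart. About `3N/4` ordered pairs are therefore close, however small `s` is; `s = 1/4` already gives
a contradiction.

For four-fold differences put `r = s/N²` and split the quadruples. Generic ones meet four blocks.
There are `N⁴ - O(N³)` of them, each hit with probability exactly `2r` for large `N`, so the mean is
`~ 2sN²`. Two hits are independent as soon as one quadruple meets a block that the other misses, so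
the variance is `O(N²)`. After normalisation by `N²` this is `O(N⁻²)`, which is summable. Degenerate
ones number `O(N³)`. If a uniform variable survives, the hit probability is at most `2r`, for an
expected total of `O(N)`. If all of them cancel, only `O(N²)` quadruples remain. Some perturbation
survives in each, with density `O(N^(3/2))`, for an expected total of `O(N^(3/2))`. Both are
`o(N²)`. The exponent `3/2` works because it lies strictly between 1 (close pairs) and 2 (bounded
loss in density). -/

open MeasureTheory ProbabilityTheory Filter Topology
open scoped ENNReal

/-! ### Integer combinations of independent circle variables. -/

section LinearCombination

variable {Ω ι : Type*}

/-- The integer combination `∑ j, c j • W j` of circle-valued random variables. -/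
noncomputable def linComb (W : ι → Ω → UnitAddCircle) (c : ι →₀ ℤ) (ω : Ω) : UnitAddCircle :=
  c.sum fun j a => a • W j ω

theorem linComb_add (W : ι → Ω → UnitAddCircle) (c d : ι →₀ ℤ) (ω : Ω) :
    linComb W (c + d) ω = linComb W c ω + linComb W d ω :=
  Finsupp.sum_add_index' (fun _ => zero_smul _ _) (fun _ _ _ => add_smul _ _ _)

theorem linComb_sub (W : ι → Ω → UnitAddCircle) (c d : ι →₀ ℤ) (ω : Ω) :
    linComb W (c - d) ω = linComb W c ω - linComb W d ω :=
  Finsupp.sum_sub_index (fun _ _ _ => sub_smul _ _ _)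

theorem linComb_single (W : ι → Ω → UnitAddCircle) (i : ι) (a : ℤ) (ω : Ω) :
    linComb W (Finsupp.single i a) ω = a • W i ω :=
  Finsupp.sum_single_index (zero_smul _ _)

theorem linComb_eq_add_erase (W : ι → Ω → UnitAddCircle) (c : ι →₀ ℤ) (i : ι) (ω : Ω) :
    linComb W c ω = c i • W i ω + linComb W (c.erase i) ω := by
  conv_lhs => rw [← Finsupp.single_add_erase i c]
  rw [linComb_add, linComb_single]

variable [MeasurableSpace Ω] {μ : Measure Ω}

theorem measurable_linComb {W : ι → Ω → UnitAddCircle} (hW : ∀ i, Measurable (W i))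
    (c : ι →₀ ℤ) : Measurable (linComb W c) := by
  unfold linComb Finsupp.sum
  refine Finset.measurable_fun_sum _ fun j _ => ?_
  exact (continuous_zsmul (c j)).measurable.comp (hW j)

/-- A member of an independent family is independent of any pair of integer combinations that do
not involve it. -/
theorem indepFun_linComb_prodMk {W : ι → Ω → UnitAddCircle} (hind : iIndepFun W μ)
    (hW : ∀ i, Measurable (W i)) {i : ι} {c d : ι →₀ ℤ} (hc : c i = 0) (hd : d i = 0) :
    IndepFun (W i) (fun ω => (linComb W c ω, linComb W d ω)) μ := by
  classical
  set T : Finset ι := c.support ∪ d.support with hT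
  have hdisj : Disjoint ({i} : Finset ι) T := by
    simp [hT, hc, hd]
  have h := hind.indepFun_finset {i} T hdisj hW
  have key : ∀ e : ι →₀ ℤ, e.support ⊆ T → ∀ ω,
      linComb W e ω = ∑ j : T, e j • W j ω := by
    intro e he ω
    unfold linComb
    rw [Finsupp.sum_of_support_subset e he _ (by simp), ← Finset.sum_coe_sort T]
  have hmeas : ∀ e : ι →₀ ℤ, Measurable (fun v : T → UnitAddCircle => ∑ j : T, e j • v j) := by
    intro e
    refine Finset.measurable_fun_sum _ fun j _ => ?_
    exact (continuous_zsmul (e j)).measurable.comp (measurable_pi_apply j)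
  have hproj : Measurable fun v : ({i} : Finset ι) → UnitAddCircle => v ⟨i, by simp⟩ :=
    measurable_pi_apply _
  have h2 := h.comp hproj ((hmeas c).prodMk (hmeas d))
  convert! h2 using 1
  funext ω
  simp only [Function.comp_apply]
  rw [key c Finset.subset_union_left, key d Finset.subset_union_right]

/-- Multiplication by a nonzero integer preserves Haar measure on the circle, so coefficients such
as `±2`, from repeated indices, cost nothing. -/
theorem map_zsmul_le {K : ℝ≥0∞} {ν : Measure UnitAddCircle} (hν : ν ≤ K • volume) {a : ℤ}
    (ha : a ≠ 0) : ν.map (fun u => a • u) ≤ K • volume := by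
  have hm : MeasurePreserving (fun u : UnitAddCircle => a • u) volume volume :=
    MeasureTheory.Measure.measurePreserving_zsmul volume ha
  calc ν.map (fun u => a • u) ≤ (K • volume).map (fun u => a • u) :=
        Measure.map_mono hν hm.measurable
    _ = K • volume := by rw [Measure.map_smul, hm.map_eq]

/-- Joint law of a sum of two independent variables together with an event of the second. -/
theorem measure_add_mem_inter [IsFiniteMeasure μ] {U V Z : Ω → UnitAddCircle} (hU : Measurable U)
    (hV : Measurable V) (hZ : Measurable Z) (hind : IndepFun U (fun ω => (V ω, Z ω)) μ)
    {S A : Set UnitAddCircle} (hS : MeasurableSet S) (hA : MeasurableSet A) :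
    μ {ω | U ω + V ω ∈ S ∧ Z ω ∈ A} =
      ∫⁻ y in Prod.snd ⁻¹' A, μ.map U ((fun u => u + y.1) ⁻¹' S)
        ∂(μ.map fun ω => (V ω, Z ω)) := by
  have hVZ : Measurable fun ω => (V ω, Z ω) := hV.prodMk hZ
  set D : Set (UnitAddCircle × UnitAddCircle × UnitAddCircle) :=
    {t | t.1 + t.2.1 ∈ S ∧ t.2.2 ∈ A} with hD
  have hDm : MeasurableSet D :=
    ((measurable_fst.add (measurable_fst.comp measurable_snd)) hS).inter
      ((measurable_snd.comp measurable_snd) hA)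
  have h1 : μ {ω | U ω + V ω ∈ S ∧ Z ω ∈ A} = μ.map (fun ω => (U ω, (V ω, Z ω))) D := by
    rw [Measure.map_apply (hU.prodMk hVZ) hDm]; rfl
  rw [h1, (indepFun_iff_map_prod_eq_prod_map_map hU.aemeasurable hVZ.aemeasurable).1 hind,
    Measure.prod_apply_symm hDm, ← lintegral_indicator (measurable_snd hA)]
  refine lintegral_congr fun y => ?_
  by_cases hy : y.2 ∈ A
  · rw [Set.indicator_of_mem (by exact hy)]
    congr 1
    ext u; simp [hD, hy]
  · rw [Set.indicator_of_notMem (by exact hy)]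
    have : (fun u => (u, y)) ⁻¹' D = ∅ := by
      ext u; simp [hD, hy]
    rw [this, measure_empty]

/-- If the `i`-th variable has density at most `K` and occurs in the combination `c`, then `c`
falls into a given ball with probability at most `K` times its volume. -/
theorem measure_norm_linComb_le [IsProbabilityMeasure μ] {W : ι → Ω → UnitAddCircle}
    (hind : iIndepFun W μ) (hW : ∀ i, Measurable (W i)) {i : ι} {K : ℝ≥0∞}
    (hK : μ.map (W i) ≤ K • volume) {c : ι →₀ ℤ} (hc : c i ≠ 0) (r : ℝ) :
    μ {ω | ‖linComb W c ω‖ ≤ r} ≤ K * volume (Metric.closedBall (0 : UnitAddCircle) r) := by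
  have hz : Measurable fun u : UnitAddCircle => c i • u := (continuous_zsmul _).measurable
  -- The second event is a dummy (`d = 0`, `A = univ`). Given the other variables, the event says
  -- that `c i • W i` lies in a translate of the ball.
  have hI := (indepFun_linComb_prodMk hind hW (i := i) (c := c.erase i) (d := 0)
    (Finsupp.erase_same) rfl).comp hz measurable_id
  have h := measure_add_mem_inter (μ := μ) (hz.comp (hW i)) (measurable_linComb hW (c.erase i))
    (measurable_linComb hW 0) hI
    (Metric.isClosed_closedBall (x := (0 : UnitAddCircle)) (ε := r)).measurableSet
    MeasurableSet.univ
  have hset : {ω | ‖linComb W c ω‖ ≤ r} = {ω | ((fun u => c i • u) ∘ W i) ω +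
      linComb W (c.erase i) ω ∈ Metric.closedBall (0 : UnitAddCircle) r ∧
        linComb W 0 ω ∈ Set.univ} := by
    ext ω; simp [linComb_eq_add_erase W c i ω]
  rw [hset, h]
  have hb : ∀ y : UnitAddCircle × UnitAddCircle, μ.map ((fun u => c i • u) ∘ W i)
      ((fun u => u + y.1) ⁻¹' Metric.closedBall (0 : UnitAddCircle) r) ≤
        K * volume (Metric.closedBall (0 : UnitAddCircle) r) := by
    intro y
    rw [← Measure.map_map hz (hW i)]
    refine (map_zsmul_le hK hc _).trans (le_of_eq ?_)
    rw [Measure.smul_apply, smul_eq_mul, measure_preimage_add_right]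
  have : IsProbabilityMeasure (μ.map fun ω => (linComb W (c.erase i) ω, linComb W 0 ω)) :=
    Measure.isProbabilityMeasure_map
      ((measurable_linComb hW _).prodMk (measurable_linComb hW _)).aemeasurable
  refine (lintegral_mono hb).trans ?_
  simp

/-- If the uniform variable `W i` occurs in `c` but not in `d`, then the events that `c` and `d`
fall into balls are independent, and the probability of the former is the volume of the ball. -/
theorem measure_norm_linComb_le_inter [IsProbabilityMeasure μ] {W : ι → Ω → UnitAddCircle}
    (hind : iIndepFun W μ) (hW : ∀ i, Measurable (W i)) {i : ι}
    (hu : μ.map (W i) = volume) {c d : ι →₀ ℤ} (hc : c i ≠ 0) (hd : d i = 0) (r : ℝ) :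
    μ {ω | ‖linComb W c ω‖ ≤ r ∧ ‖linComb W d ω‖ ≤ r} =
      volume (Metric.closedBall (0 : UnitAddCircle) r) * μ {ω | ‖linComb W d ω‖ ≤ r} := by
  have hz : Measurable fun u : UnitAddCircle => c i • u := (continuous_zsmul _).measurable
  have hB : MeasurableSet (Metric.closedBall (0 : UnitAddCircle) r) :=
    Metric.isClosed_closedBall.measurableSet
  have hI := (indepFun_linComb_prodMk hind hW (i := i) (c := c.erase i) (d := d)
    (Finsupp.erase_same) hd).comp hz measurable_id
  have h := measure_add_mem_inter (μ := μ) (hz.comp (hW i)) (measurable_linComb hW (c.erase i))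
    (measurable_linComb hW d) hI hB hB
  have hset : {ω | ‖linComb W c ω‖ ≤ r ∧ ‖linComb W d ω‖ ≤ r} =
      {ω | ((fun u => c i • u) ∘ W i) ω +
      linComb W (c.erase i) ω ∈ Metric.closedBall (0 : UnitAddCircle) r ∧
        linComb W d ω ∈ Metric.closedBall (0 : UnitAddCircle) r} := by
    ext ω; simp [linComb_eq_add_erase W c i ω]
  rw [hset, h]
  have hb : ∀ y : UnitAddCircle × UnitAddCircle, μ.map ((fun u => c i • u) ∘ W i)
      ((fun u => u + y.1) ⁻¹' Metric.closedBall (0 : UnitAddCircle) r) =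
        volume (Metric.closedBall (0 : UnitAddCircle) r) := by
    intro y
    rw [← Measure.map_map hz (hW i), hu, (MeasureTheory.Measure.measurePreserving_zsmul volume hc).map_eq,
      measure_preimage_add_right]
  simp_rw [hb]
  rw [setLIntegral_const, Measure.map_apply
    ((measurable_linComb hW _).prodMk (measurable_linComb hW _)) (measurable_snd hB)]
  congr 2
  ext ω; simp

theorem measure_norm_linComb_eq [IsProbabilityMeasure μ] {W : ι → Ω → UnitAddCircle}
    (hind : iIndepFun W μ) (hW : ∀ i, Measurable (W i)) {i : ι}
    (hu : μ.map (W i) = volume) {c : ι →₀ ℤ} (hc : c i ≠ 0) {r : ℝ} (hr : 0 ≤ r) :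
    μ {ω | ‖linComb W c ω‖ ≤ r} = volume (Metric.closedBall (0 : UnitAddCircle) r) := by
  -- For `d = 0` and `r ≥ 0` the second event is everything.
  have h := measure_norm_linComb_le_inter hind hW hu (d := 0) hc rfl r
  simpa [linComb, hr] using h

end LinearCombination

/-! ### Probabilistic tools: joining families, density of a perturbation, almost sure convergence.
-/

/-- Two independent families of independent variables form a single independent family. -/
theorem iIndepFun_sumElim {Ω ι κ β : Type*} [MeasurableSpace Ω] [MeasurableSpace β]
    {μ : Measure Ω} [IsProbabilityMeasure μ] {f : ι → Ω → β} {g : κ → Ω → β}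
    (hf : iIndepFun f μ) (hg : iIndepFun g μ)
    (hfg : IndepFun (fun ω i => f i ω) (fun ω k => g k ω) μ) :
    iIndepFun (Sum.elim f g) μ := by
  classical
  rw [iIndepFun_iff_measure_inter_preimage_eq_mul]
  intro S sets hS
  have hL := hf.measure_inter_preimage_eq_mul S.toLeft (sets := fun i => sets (Sum.inl i))
    (fun i hi => hS _ (Finset.mem_toLeft.1 hi))
  have hR := hg.measure_inter_preimage_eq_mul S.toRight (sets := fun i => sets (Sum.inr i))
    (fun i hi => hS _ (Finset.mem_toRight.1 hi))
  have h := hfg.measure_inter_preimage_eq_mul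
    (⋂ i ∈ S.toLeft, (fun v : ι → β => v i) ⁻¹' sets (Sum.inl i))
    (⋂ i ∈ S.toRight, (fun v : κ → β => v i) ⁻¹' sets (Sum.inr i))
    (Finset.measurableSet_biInter _ fun i hi =>
      measurable_pi_apply i (hS _ (Finset.mem_toLeft.1 hi)))
    (Finset.measurableSet_biInter _ fun i hi =>
      measurable_pi_apply i (hS _ (Finset.mem_toRight.1 hi)))
  have hset : (⋂ i ∈ S, Sum.elim f g i ⁻¹' sets i) =
      (fun ω i => f i ω) ⁻¹' (⋂ i ∈ S.toLeft, (fun v : ι → β => v i) ⁻¹' sets (Sum.inl i)) ∩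
      (fun ω k => g k ω) ⁻¹' (⋂ i ∈ S.toRight, (fun v : κ → β => v i) ⁻¹' sets (Sum.inr i)) := by
    ext ω
    simp [Set.mem_iInter, Sum.forall]
  rw [hset, h]
  conv_rhs => rw [← Finset.toLeft_disjSum_toRight (u := S), Finset.prod_disjSum]
  simp only [Sum.elim_inl, Sum.elim_inr]
  rw [← hL, ← hR]
  simp [Set.preimage_iInter, Set.preimage_preimage]

/-- The reduction modulo one of a variable that is uniform on `[-h, h]`, `h ≤ 1`, has bounded
density. -/
theorem map_coe_le_of_isUniform {Ω : Type*} [MeasurableSpace Ω] {μ : Measure Ω}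
    {p : Ω → ℝ} (hp : Measurable p) {h : ℝ} (h0 : 0 < h) (h1 : h ≤ 1)
    (hu : pdf.IsUniform p (Set.Icc (-h) h) μ volume) :
    μ.map (fun ω => (p ω : UnitAddCircle)) ≤ ENNReal.ofReal (2 * h⁻¹) • volume := by
  have hmk : Measurable ((↑) : ℝ → UnitAddCircle) := AddCircle.measurable_mk'
  have e : μ.map (fun ω => (p ω : UnitAddCircle)) = (μ.map p).map ((↑) : ℝ → UnitAddCircle) := by
    rw [Measure.map_map hmk hp]; rfl
  have hle : (volume.restrict (Set.Icc (-h) h)).map ((↑) : ℝ → UnitAddCircle) ≤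
      (3 : ℝ≥0∞) • volume := by
    -- Each half-open unit interval maps onto the circle preserving measure; the leftmost one only
    -- serves the endpoint `-1`. The resulting density bound `3/(2h)` is at most `2/h`.
    have hsub : Set.Icc (-h) h ⊆ Set.Ioc (-2 : ℝ) (-2 + 1) ∪ (Set.Ioc (-1 : ℝ) (-1 + 1) ∪
        Set.Ioc (0 : ℝ) (0 + 1)) := by
      intro t ht
      simp only [Set.mem_union, Set.mem_Ioc]
      rcases le_or_gt t (-1) with h' | h'
      · left; constructor <;> linarith [ht.1]
      · rcases le_or_gt t 0 with h'' | h''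
        · right; left; constructor <;> linarith
        · right; right; constructor <;> linarith [ht.2]
    have hr : volume.restrict (Set.Icc (-h) h) ≤ volume.restrict (Set.Ioc (-2 : ℝ) (-2 + 1)) +
        (volume.restrict (Set.Ioc (-1 : ℝ) (-1 + 1)) + volume.restrict (Set.Ioc (0 : ℝ) (0 + 1))) :=
      (Measure.restrict_mono_set _ hsub).trans ((Measure.restrict_union_le _ _).trans
        (add_le_add le_rfl (Measure.restrict_union_le _ _)))
    refine (Measure.map_mono hr hmk).trans (le_of_eq ?_)
    rw [Measure.map_add _ _ hmk, Measure.map_add _ _ hmk,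
      (UnitAddCircle.measurePreserving_mk (-2)).map_eq,
      (UnitAddCircle.measurePreserving_mk (-1)).map_eq,
      (UnitAddCircle.measurePreserving_mk 0).map_eq, ← add_assoc]
    ext s hs
    simp only [Measure.add_apply, Measure.smul_apply, smul_eq_mul]
    ring
  rw [e, hu, ProbabilityTheory.cond, Measure.map_smul, Real.volume_Icc]
  refine Measure.le_iff'.2 fun s => ?_
  have hs := hle s
  simp only [Measure.smul_apply, smul_eq_mul] at hs ⊢
  refine (mul_le_mul_right hs _).trans ?_
  rw [← mul_assoc]
  refine mul_le_mul_left ?_ _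
  rw [← ENNReal.ofReal_inv_of_pos (by linarith), ← ENNReal.ofReal_ofNat 3,
    ← ENNReal.ofReal_mul (by rw [inv_nonneg]; linarith)]
  refine ENNReal.ofReal_le_ofReal ?_
  have : (h - -h)⁻¹ = h⁻¹ / 2 := by
    rw [show h - -h = h * 2 by ring, mul_inv]; ring
  rw [this]
  have := inv_pos.2 h0
  linarith

/-- Nonnegative variables with summable expectations tend to zero almost surely. -/
theorem ae_tendsto_zero_of_summable_lintegral {Ω : Type*} [MeasurableSpace Ω] {μ : Measure Ω}
    {X : ℕ → Ω → ℝ} (hX : ∀ n, Measurable (X n)) (h0 : ∀ n ω, 0 ≤ X n ω) {a : ℕ → ℝ}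
    (ha0 : ∀ n, 0 ≤ a n) (ha : Summable a)
    (hle : ∀ n, ∫⁻ ω, ENNReal.ofReal (X n ω) ∂μ ≤ ENNReal.ofReal (a n)) :
    ∀ᵐ ω ∂μ, Tendsto (fun n => X n ω) atTop (𝓝 0) := by
  have hm : ∀ n, Measurable fun ω => ENNReal.ofReal (X n ω) := fun n => (hX n).ennreal_ofReal
  have hfin : ∫⁻ ω, ∑' n, ENNReal.ofReal (X n ω) ∂μ ≠ ∞ := by
    rw [lintegral_tsum fun n => (hm n).aemeasurable]
    refine ne_top_of_le_ne_top ?_ (ENNReal.tsum_le_tsum hle)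
    rw [← ENNReal.ofReal_tsum_of_nonneg ha0 ha]
    exact ENNReal.ofReal_ne_top
  filter_upwards [ae_lt_top (Measurable.tsum hm) hfin] with ω hω
  have h := ENNReal.tendsto_atTop_zero_of_tsum_ne_top hω.ne
  have h2 := (ENNReal.tendsto_toReal (a := 0) (by simp)).comp h
  refine h2.congr fun n => ?_
  simp [ENNReal.toReal_ofReal (h0 n ω)]

/-! ### Combinatorics of quadruples and their coefficients. -/

/-- Coefficients of the `i`-th point `W (inl (i / 2)) + W (inr i)` of the sequence. -/
noncomputable def pointCoeff (i : ℕ) : ℕ ⊕ ℕ →₀ ℤ :=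
  Finsupp.single (Sum.inl (i / 2)) 1 + Finsupp.single (Sum.inr i) 1

/-- Coefficients of the four-fold difference with indices `q`. -/
noncomputable def fourCoeff (q : ℕ × ℕ × ℕ × ℕ) : ℕ ⊕ ℕ →₀ ℤ :=
  pointCoeff q.1 + pointCoeff q.2.1 - pointCoeff q.2.2.1 - pointCoeff q.2.2.2

theorem linComb_fourCoeff {Ω : Type*} (W : ℕ ⊕ ℕ → Ω → UnitAddCircle) (m n k l : ℕ) (ω : Ω) :
    linComb W (fourCoeff (m, n, k, l)) ω =
      (W (Sum.inl (m / 2)) ω + W (Sum.inr m) ω) + (W (Sum.inl (n / 2)) ω + W (Sum.inr n) ω) -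
      (W (Sum.inl (k / 2)) ω + W (Sum.inr k) ω) - (W (Sum.inl (l / 2)) ω + W (Sum.inr l) ω) := by
  simp only [fourCoeff, pointCoeff, linComb_sub, linComb_add, linComb_single, one_smul]

theorem fourCoeff_inl (m n k l b : ℕ) : fourCoeff (m, n, k, l) (Sum.inl b) =
    (if m / 2 = b then 1 else 0) + (if n / 2 = b then 1 else 0) -
      (if k / 2 = b then 1 else 0) - (if l / 2 = b then 1 else 0) := by
  simp [fourCoeff, pointCoeff, Finsupp.single_apply]

theorem fourCoeff_inr (m n k l i : ℕ) : fourCoeff (m, n, k, l) (Sum.inr i) =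
    (if m = i then 1 else 0) + (if n = i then 1 else 0) -
      (if k = i then 1 else 0) - (if l = i then 1 else 0) := by
  simp [fourCoeff, pointCoeff, Finsupp.single_apply]

/-- All quadruples of indices below `N`. -/
def quadruples (N : ℕ) : Finset (ℕ × ℕ × ℕ × ℕ) :=
  Finset.range N ×ˢ Finset.range N ×ˢ Finset.range N ×ˢ Finset.range N

theorem card_quadruples (N : ℕ) : (quadruples N).card = N ^ 4 := by
  simp [quadruples]; ring

/-- The four indices lie in four different blocks `{2 b, 2 b + 1}`. -/
def BlockDistinct (q : ℕ × ℕ × ℕ × ℕ) : Prop :=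
  q.1 / 2 ≠ q.2.1 / 2 ∧ q.1 / 2 ≠ q.2.2.1 / 2 ∧ q.1 / 2 ≠ q.2.2.2 / 2 ∧
    q.2.1 / 2 ≠ q.2.2.1 / 2 ∧ q.2.1 / 2 ≠ q.2.2.2 / 2 ∧ q.2.2.1 / 2 ≠ q.2.2.2 / 2

instance : DecidablePred BlockDistinct := fun _ => by unfold BlockDistinct; infer_instance

/-- The blocks met by a quadruple. -/
def blocks (q : ℕ × ℕ × ℕ × ℕ) : Finset ℕ :=
  {q.1 / 2, q.2.1 / 2, q.2.2.1 / 2, q.2.2.2 / 2}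

theorem BlockDistinct.fourCoeff_ne_zero {q : ℕ × ℕ × ℕ × ℕ} (hq : BlockDistinct q) {b : ℕ}
    (hb : b ∈ blocks q) : fourCoeff q (Sum.inl b) ≠ 0 := by
  obtain ⟨m, n, k, l⟩ := q
  simp only [BlockDistinct, blocks, Finset.mem_insert, Finset.mem_singleton] at hq hb
  rw [fourCoeff_inl]
  obtain ⟨h1, h2, h3, h4, h5, h6⟩ := hq
  rcases hb with rfl | rfl | rfl | rfl
  · simp [h1.symm, h2.symm, h3.symm]
  · simp [h1, h4.symm, h5.symm]
  · simp [h2, h4, h6.symm]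
  · simp [h3, h5, h6]

theorem fourCoeff_eq_zero_of_notMem {q : ℕ × ℕ × ℕ × ℕ} {b : ℕ} (hb : b ∉ blocks q) :
    fourCoeff q (Sum.inl b) = 0 := by
  obtain ⟨m, n, k, l⟩ := q
  simp only [blocks, Finset.mem_insert, Finset.mem_singleton, not_or] at hb
  obtain ⟨h1, h2, h3, h4⟩ := hb
  rw [fourCoeff_inl]
  simp [Ne.symm h1, Ne.symm h2, Ne.symm h3, Ne.symm h4]

theorem BlockDistinct.pair_ne {m n k l : ℕ} (hq : BlockDistinct (m, n, k, l)) :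
    ({m, n} : Finset ℕ) ≠ {k, l} := by
  intro h
  have : m ∈ ({k, l} : Finset ℕ) := h ▸ Finset.mem_insert_self m _
  simp only [Finset.mem_insert, Finset.mem_singleton] at this
  simp only [BlockDistinct] at hq
  rcases this with rfl | rfl
  · exact hq.2.1 rfl
  · exact hq.2.2.1 rfl

/-- The perturbation coefficient of `i` is its multiplicity in `m, n` minus that in `k, l`; if all
vanish, the two sets agree. The bound `i < N` gives control of the density. -/
theorem exists_fourCoeff_inr_ne_zero {m n k l : ℕ} (h : ({m, n} : Finset ℕ) ≠ {k, l}) {N : ℕ}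
    (hq : (m, n, k, l) ∈ quadruples N) : ∃ i < N, fourCoeff (m, n, k, l) (Sum.inr i) ≠ 0 := by
  simp only [quadruples, Finset.mem_product, Finset.mem_range] at hq
  by_contra! hc
  apply h
  have hm := hc m hq.1
  have hn := hc n hq.2.1
  have hk := hc k hq.2.2.1
  have hl := hc l hq.2.2.2
  rw [fourCoeff_inr] at hm hn hk hl
  ext i
  simp only [Finset.mem_insert, Finset.mem_singleton]
  have hi : (m = i ∨ n = i ∨ k = i ∨ l = i) → fourCoeff (m, n, k, l) (Sum.inr i) = 0 := by
    rintro (rfl | rfl | rfl | rfl)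
    exacts [hc _ hq.1, hc _ hq.2.1, hc _ hq.2.2.1, hc _ hq.2.2.2]
  rw [fourCoeff_inr] at hi
  constructor
  · intro h'
    have := hi (by tauto)
    by_contra! h''
    simp only [h''.1.symm, h''.2.symm, if_false] at this
    rcases h' with rfl | rfl <;> simp at this <;> split_ifs at this <;> omega
  · intro h'
    have := hi (by tauto)
    by_contra! h''
    simp only [h''.1.symm, h''.2.symm, if_false] at this
    rcases h' with rfl | rfl <;> simp at this <;> split_ifs at this <;> omega

/-- At most four blocks of two indices leave 8 choices per slot, hence `8⁴`. -/
theorem card_blocks_subset_le (q : ℕ × ℕ × ℕ × ℕ) (N : ℕ) :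
    ((quadruples N).filter fun q' => blocks q' ⊆ blocks q).card ≤ 4096 := by
  set S : Finset ℕ := (blocks q ×ˢ Finset.range 2).image fun t => 2 * t.1 + t.2 with hS
  have hb : (blocks q).card ≤ 4 := Finset.card_le_four
  have hScard : S.card ≤ 8 := by
    refine Finset.card_image_le.trans ?_
    rw [Finset.card_product, Finset.card_range]; omega
  have hmem : ∀ i, i / 2 ∈ blocks q → i ∈ S := by
    intro i hi
    rw [hS, Finset.mem_image]
    exact ⟨(i / 2, i % 2), Finset.mem_product.2 ⟨hi, Finset.mem_range.2 (Nat.mod_lt _ two_pos)⟩,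
      Nat.div_add_mod i 2⟩
  calc _ ≤ (S ×ˢ S ×ˢ S ×ˢ S).card := by
        refine Finset.card_le_card fun t ht => ?_
        have ht' := (Finset.mem_filter.1 ht).2
        simp only [Finset.mem_product]
        refine ⟨hmem _ (ht' ?_), hmem _ (ht' ?_), hmem _ (ht' ?_), hmem _ (ht' ?_)⟩ <;>
          simp [blocks]
    _ = S.card ^ 4 := by simp only [Finset.card_product]; ring
    _ ≤ 8 ^ 4 := Nat.pow_le_pow_left hScard 4
    _ = 4096 := by norm_num

/-- One of six pairs of indices shares a block. Three free indices and the parity of the fourth then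
determine the quadruple: `6 · 2N³`. -/
theorem card_not_blockDistinct_le (N : ℕ) :
    ((quadruples N).filter fun q => ¬ BlockDistinct q).card ≤ 12 * N ^ 3 := by
  set D := Finset.range N ×ˢ Finset.range N ×ˢ Finset.range N ×ˢ Finset.range 2 with hD
  have hDcard : D.card = 2 * N ^ 3 := by simp [hD]; ring
  set f : ℕ → ℕ → ℕ := fun i e => 2 * (i / 2) + e with hf
  have hex : ∀ i j, i / 2 = j / 2 → ∃ e < 2, j = f i e := fun i j h =>
    ⟨j % 2, Nat.mod_lt _ two_pos, by simp only [hf]; omega⟩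
  set g1 : ℕ × ℕ × ℕ × ℕ → ℕ × ℕ × ℕ × ℕ := fun t => (t.1, f t.1 t.2.2.2, t.2.1, t.2.2.1) with hg1
  set g2 : ℕ × ℕ × ℕ × ℕ → ℕ × ℕ × ℕ × ℕ := fun t => (t.1, t.2.1, f t.1 t.2.2.2, t.2.2.1) with hg2
  set g3 : ℕ × ℕ × ℕ × ℕ → ℕ × ℕ × ℕ × ℕ := fun t => (t.1, t.2.1, t.2.2.1, f t.1 t.2.2.2) with hg3
  set g4 : ℕ × ℕ × ℕ × ℕ → ℕ × ℕ × ℕ × ℕ := fun t => (t.1, t.2.1, f t.2.1 t.2.2.2, t.2.2.1) with hg4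
  set g5 : ℕ × ℕ × ℕ × ℕ → ℕ × ℕ × ℕ × ℕ := fun t => (t.1, t.2.1, t.2.2.1, f t.2.1 t.2.2.2) with hg5
  set g6 : ℕ × ℕ × ℕ × ℕ → ℕ × ℕ × ℕ × ℕ := fun t => (t.1, t.2.1, t.2.2.1, f t.2.2.1 t.2.2.2) with hg6
  have hsub : (quadruples N).filter (fun q => ¬ BlockDistinct q) ⊆
      D.image g1 ∪ (D.image g2 ∪ (D.image g3 ∪ (D.image g4 ∪ (D.image g5 ∪ D.image g6)))) := by
    rintro ⟨m, n, k, l⟩ hq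
    simp only [quadruples, Finset.mem_filter, Finset.mem_product, Finset.mem_range] at hq
    obtain ⟨⟨hm, hn, hk, hl⟩, hnot⟩ := hq
    have hD' : ∀ {a b c e : ℕ}, a < N → b < N → c < N → e < 2 → (a, b, c, e) ∈ D := by
      intro a b c e ha hb hc he
      simp [hD, ha, hb, hc, he]
    simp only [Finset.mem_union, Finset.mem_image]
    by_cases h1 : m / 2 = n / 2
    · obtain ⟨e, he, rfl⟩ := hex _ _ h1
      exact Or.inl ⟨(m, k, l, e), hD' hm hk hl he, rfl⟩
    by_cases h2 : m / 2 = k / 2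
    · obtain ⟨e, he, rfl⟩ := hex _ _ h2
      exact Or.inr (Or.inl ⟨(m, n, l, e), hD' hm hn hl he, rfl⟩)
    by_cases h3 : m / 2 = l / 2
    · obtain ⟨e, he, rfl⟩ := hex _ _ h3
      exact Or.inr (Or.inr (Or.inl ⟨(m, n, k, e), hD' hm hn hk he, rfl⟩))
    by_cases h4 : n / 2 = k / 2
    · obtain ⟨e, he, rfl⟩ := hex _ _ h4
      exact Or.inr (Or.inr (Or.inr (Or.inl ⟨(m, n, l, e), hD' hm hn hl he, rfl⟩)))
    by_cases h5 : n / 2 = l / 2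
    · obtain ⟨e, he, rfl⟩ := hex _ _ h5
      exact Or.inr (Or.inr (Or.inr (Or.inr (Or.inl ⟨(m, n, k, e), hD' hm hn hk he, rfl⟩))))
    by_cases h6 : k / 2 = l / 2
    · obtain ⟨e, he, rfl⟩ := hex _ _ h6
      exact Or.inr (Or.inr (Or.inr (Or.inr (Or.inr ⟨(m, n, k, e), hD' hm hn hk he, rfl⟩))))
    exact absurd ⟨h1, h2, h3, h4, h5, h6⟩ hnot
  have hi : ∀ g : ℕ × ℕ × ℕ × ℕ → ℕ × ℕ × ℕ × ℕ, (D.image g).card ≤ 2 * N ^ 3 :=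
    fun g => Finset.card_image_le.trans hDcard.le
  have hU : ∀ {A B : Finset (ℕ × ℕ × ℕ × ℕ)} {a b : ℕ}, A.card ≤ a → B.card ≤ b →
      (A ∪ B).card ≤ a + b := fun ha hb => (Finset.card_union_le _ _).trans (add_le_add ha hb)
  refine (Finset.card_le_card hsub).trans ((hU (hi _) (hU (hi _) (hU (hi _) (hU (hi _)
    (hU (hi _) (hi _)))))).trans (le_of_eq ?_))
  ring

/-- Cancellation at the blocks of `k` and `l` forces both into the blocks of `m` or `n`, so given
`m, n` each has four candidates: `4 · 4 · N²`. -/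
theorem card_fourCoeff_inl_eq_zero_le (N : ℕ) (s : Finset (ℕ × ℕ × ℕ × ℕ))
    (hs : s ⊆ quadruples N) (h0 : ∀ q ∈ s, ∀ b, fourCoeff q (Sum.inl b) = 0) :
    s.card ≤ 16 * N ^ 2 := by
  set f : ℕ → ℕ → ℕ → ℕ := fun m n e =>
    if e < 2 then 2 * (m / 2) + e else 2 * (n / 2) + (e - 2) with hf
  have hex : ∀ m n j, (j / 2 = m / 2 ∨ j / 2 = n / 2) → ∃ e < 4, f m n e = j := by
    intro m n j h
    rcases h with h | h
    · refine ⟨j % 2, by omega, ?_⟩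
      simp only [hf, Nat.mod_lt j two_pos, if_true]; omega
    · refine ⟨j % 2 + 2, by omega, ?_⟩
      simp only [hf, show ¬ (j % 2 + 2 < 2) by omega, if_false]; omega
  have hsub : s ⊆ (Finset.range N ×ˢ Finset.range N ×ˢ Finset.range 4 ×ˢ Finset.range 4).image
      fun t => (t.1, t.2.1, f t.1 t.2.1 t.2.2.1, f t.1 t.2.1 t.2.2.2) := by
    rintro ⟨m, n, k, l⟩ hq
    have hN := hs hq
    have hk := h0 _ hq (k / 2)
    have hl := h0 _ hq (l / 2)
    rw [fourCoeff_inl] at hk hl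
    simp only [quadruples, Finset.mem_product, Finset.mem_range] at hN
    have hk' : k / 2 = m / 2 ∨ k / 2 = n / 2 := by
      by_contra! hc
      simp only [hc.1.symm, hc.2.symm, if_false, if_true] at hk
      split_ifs at hk <;> omega
    have hl' : l / 2 = m / 2 ∨ l / 2 = n / 2 := by
      by_contra! hc
      simp only [hc.1.symm, hc.2.symm, if_false, if_true] at hl
      split_ifs at hl <;> omega
    obtain ⟨e, he, hek⟩ := hex m n k hk'
    obtain ⟨e', he', hel⟩ := hex m n l hl'
    rw [Finset.mem_image]
    refine ⟨(m, n, e, e'), ?_, by simp [hek, hel]⟩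
    simp [hN.1, hN.2.1, he, he']
  refine (Finset.card_le_card hsub).trans (Finset.card_image_le.trans (le_of_eq ?_))
  simp; ring

/-! ### Second moment method and hit counts. -/

/-- Second moment bound for a sum of indicators of events of equal probability, each of which is
uncorrelated with all but at most `C` of the others. -/
theorem integral_sum_indicator_sub_sq_le {Ω α : Type*} [MeasurableSpace Ω] {μ : Measure Ω}
    [IsProbabilityMeasure μ] (G : Finset α) (E : α → Set Ω) (hE : ∀ a, MeasurableSet (E a))
    {π : ℝ} (hπ : ∀ a ∈ G, μ.real (E a) = π) (bad : α → Finset α) {C : ℕ}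
    (hC : ∀ a ∈ G, (bad a).card ≤ C)
    (hgood : ∀ a ∈ G, ∀ b ∈ G, b ∉ bad a → μ.real (E a ∩ E b) = π ^ 2) :
    ∫ ω, (∑ a ∈ G, (E a).indicator (fun _ => (1 : ℝ)) ω - G.card * π) ^ 2 ∂μ ≤
      G.card * (C * π) := by
  classical
  have hint : ∀ a, Integrable ((E a).indicator fun _ => (1 : ℝ)) μ := fun a =>
    (integrable_const 1).indicator (hE a)
  have hexp : ∀ ω, (∑ a ∈ G, (E a).indicator (fun _ => (1 : ℝ)) ω - G.card * π) ^ 2 =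
      ∑ a ∈ G, ∑ b ∈ G, ((E a ∩ E b).indicator (fun _ => (1 : ℝ)) ω -
        π * (E a).indicator (fun _ => (1 : ℝ)) ω - π * (E b).indicator (fun _ => (1 : ℝ)) ω +
        π ^ 2) := by
    intro ω
    have : ∑ a ∈ G, (E a).indicator (fun _ => (1 : ℝ)) ω - G.card * π =
        ∑ a ∈ G, ((E a).indicator (fun _ => (1 : ℝ)) ω - π) := by
      rw [Finset.sum_sub_distrib, Finset.sum_const, nsmul_eq_mul]
    rw [this, sq, Finset.sum_mul_sum]
    refine Finset.sum_congr rfl fun a _ => Finset.sum_congr rfl fun b _ => ?_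
    have : (E a ∩ E b).indicator (fun _ => (1 : ℝ)) ω =
        (E a).indicator (fun _ => (1 : ℝ)) ω * (E b).indicator (fun _ => (1 : ℝ)) ω := by
      simp only [Set.indicator_apply, Set.mem_inter_iff]
      split_ifs <;> simp_all
    rw [this]; ring
  have hint2 : ∀ a b, Integrable (fun ω => (E a ∩ E b).indicator (fun _ => (1 : ℝ)) ω -
        π * (E a).indicator (fun _ => (1 : ℝ)) ω - π * (E b).indicator (fun _ => (1 : ℝ)) ω +
        π ^ 2) μ := fun a b =>
    ((((integrable_const 1).indicator ((hE a).inter (hE b))).sub ((hint a).const_mul π)).sub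
      ((hint b).const_mul π)).add (integrable_const _)
  have hval : ∀ a ∈ G, ∀ b ∈ G, ∫ ω, ((E a ∩ E b).indicator (fun _ => (1 : ℝ)) ω -
        π * (E a).indicator (fun _ => (1 : ℝ)) ω - π * (E b).indicator (fun _ => (1 : ℝ)) ω +
        π ^ 2) ∂μ = μ.real (E a ∩ E b) - π ^ 2 := by
    intro a ha b hb
    have hi := (integrable_const (μ := μ) (1 : ℝ)).indicator ((hE a).inter (hE b))
    have hi1 : Integrable (fun ω => (E a ∩ E b).indicator (fun _ => (1 : ℝ)) ω -
        π * (E a).indicator (fun _ => (1 : ℝ)) ω) μ := hi.sub ((hint a).const_mul π)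
    have hi2 : Integrable (fun ω => (E a ∩ E b).indicator (fun _ => (1 : ℝ)) ω -
        π * (E a).indicator (fun _ => (1 : ℝ)) ω - π * (E b).indicator (fun _ => (1 : ℝ)) ω) μ :=
      hi1.sub ((hint b).const_mul π)
    rw [integral_add hi2 (integrable_const _), integral_sub hi1 ((hint b).const_mul π),
      integral_sub hi ((hint a).const_mul π), integral_const_mul, integral_const_mul,
      integral_indicator_const _ ((hE a).inter (hE b)), integral_indicator_const _ (hE a),
      integral_indicator_const _ (hE b), hπ a ha, hπ b hb]
    simp
    ring
  simp_rw [hexp]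
  rw [integral_finsetSum _ fun a _ => integrable_finsetSum _ fun b _ => hint2 a b]
  rw [← nsmul_eq_mul]
  refine Finset.sum_le_card_nsmul _ _ _ fun a ha => ?_
  have hπ0 : 0 ≤ π := hπ a ha ▸ measureReal_nonneg
  rw [integral_finsetSum _ fun b _ => hint2 a b,
    Finset.sum_congr rfl fun b hb => hval a ha b hb]
  calc ∑ b ∈ G, (μ.real (E a ∩ E b) - π ^ 2) ≤ ∑ b ∈ G, (if b ∈ bad a then π else 0) := by
        refine Finset.sum_le_sum fun b hb => ?_
        split_ifs with h
        · have : μ.real (E a ∩ E b) ≤ π := hπ a ha ▸ measureReal_mono Set.inter_subset_left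
          nlinarith [sq_nonneg π]
        · rw [hgood a ha b hb h, sub_self]
    _ = (G.filter (· ∈ bad a)).card * π := by
        rw [← Finset.sum_filter, Finset.sum_const, nsmul_eq_mul]
    _ ≤ C * π := by
        refine mul_le_mul_of_nonneg_right ?_ hπ0
        exact_mod_cast (Finset.card_le_card fun b hb => (Finset.mem_filter.1 hb).2).trans (hC a ha)

/-- The number of quadruples of `s` whose four-fold difference has norm at most `r`. -/
noncomputable def hitCount {Ω : Type*} (W : ℕ ⊕ ℕ → Ω → UnitAddCircle)
    (s : Finset (ℕ × ℕ × ℕ × ℕ)) (r : ℝ) (ω : Ω) : ℝ :=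
  ∑ q ∈ s, {ω | ‖linComb W (fourCoeff q) ω‖ ≤ r}.indicator (fun _ => (1 : ℝ)) ω

section HitCount

variable {Ω : Type*} {W : ℕ ⊕ ℕ → Ω → UnitAddCircle}

theorem hitCount_nonneg (s : Finset (ℕ × ℕ × ℕ × ℕ)) (r : ℝ) (ω : Ω) : 0 ≤ hitCount W s r ω :=
  Finset.sum_nonneg fun _ _ => Set.indicator_nonneg (fun _ _ => zero_le_one) _

theorem hitCount_mono {s t : Finset (ℕ × ℕ × ℕ × ℕ)} (hst : s ⊆ t) {r r' : ℝ} (hr : r ≤ r')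
    (ω : Ω) : hitCount W s r ω ≤ hitCount W t r' ω := by
  refine (Finset.sum_le_sum_of_subset_of_nonneg hst fun _ _ _ =>
    Set.indicator_nonneg (fun _ _ => zero_le_one) _).trans (Finset.sum_le_sum fun q _ => ?_)
  exact Set.indicator_le_indicator_of_subset (fun ω (h : _ ≤ r) => h.trans hr)
    (fun _ => zero_le_one) ω

theorem hitCount_eq_card (s : Finset (ℕ × ℕ × ℕ × ℕ)) (r : ℝ) (ω : Ω) :
    hitCount W s r ω = ((s.filter fun q => ‖linComb W (fourCoeff q) ω‖ ≤ r).card : ℝ) := by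
  rw [hitCount, Finset.card_filter]
  push_cast
  exact Finset.sum_congr rfl fun q _ => by simp [Set.indicator_apply]

/-- Quadruples whose indices lie in four different blocks. -/
def genericQuadruples (N : ℕ) : Finset (ℕ × ℕ × ℕ × ℕ) :=
  (quadruples N).filter BlockDistinct

/-- Quadruples with `{m, n} ≠ {k, l}` whose indices do not lie in four different blocks. -/
def degenerateQuadruples (N : ℕ) : Finset (ℕ × ℕ × ℕ × ℕ) :=
  (quadruples N).filter fun q =>
    ¬ BlockDistinct q ∧ ({q.1, q.2.1} : Finset ℕ) ≠ {q.2.2.1, q.2.2.2}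

theorem degenerateQuadruples_mono {M N : ℕ} (h : M ≤ N) :
    degenerateQuadruples M ⊆ degenerateQuadruples N := by
  intro q hq
  simp only [degenerateQuadruples, quadruples, Finset.mem_filter, Finset.mem_product,
    Finset.mem_range] at hq ⊢
  exact ⟨⟨by omega, by omega, by omega, by omega⟩, hq.2⟩

theorem card_genericQuadruples_le (N : ℕ) : (genericQuadruples N).card ≤ N ^ 4 :=
  (Finset.card_filter_le _ _).trans (card_quadruples N).le

theorem le_card_genericQuadruples (N : ℕ) :
    N ^ 4 ≤ (genericQuadruples N).card + 12 * N ^ 3 := by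
  have h := Finset.card_filter_add_card_filter_not (s := quadruples N) BlockDistinct
  rw [card_quadruples] at h
  have h2 := card_not_blockDistinct_le N
  unfold genericQuadruples
  omega

variable [MeasurableSpace Ω] {μ : Measure Ω}

theorem measurableSet_norm_linComb_le (hW : ∀ i, Measurable (W i)) (c : ℕ ⊕ ℕ →₀ ℤ) (r : ℝ) :
    MeasurableSet {ω | ‖linComb W c ω‖ ≤ r} :=
  (measurable_linComb hW c).norm measurableSet_Iic

theorem measurable_hitCount (hW : ∀ i, Measurable (W i)) (s : Finset (ℕ × ℕ × ℕ × ℕ)) (r : ℝ) :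
    Measurable (hitCount W s r) :=
  Finset.measurable_fun_sum _ fun q _ =>
    measurable_const.indicator (measurableSet_norm_linComb_le hW (fourCoeff q) r)

theorem lintegral_hitCount (hW : ∀ i, Measurable (W i)) (s : Finset (ℕ × ℕ × ℕ × ℕ)) (r : ℝ) :
    ∫⁻ ω, ENNReal.ofReal (hitCount W s r ω) ∂μ =
      ∑ q ∈ s, μ {ω | ‖linComb W (fourCoeff q) ω‖ ≤ r} := by
  have h : ∀ ω, ENNReal.ofReal (hitCount W s r ω) =
      ∑ q ∈ s, {ω | ‖linComb W (fourCoeff q) ω‖ ≤ r}.indicator (fun _ => (1 : ℝ≥0∞)) ω := by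
    intro ω
    rw [hitCount, ENNReal.ofReal_sum_of_nonneg fun _ _ =>
      Set.indicator_nonneg (fun _ _ => zero_le_one) _]
    refine Finset.sum_congr rfl fun q _ => ?_
    simp only [Set.indicator_apply]
    split_ifs <;> simp
  simp_rw [h]
  rw [lintegral_finsetSum _ fun q _ =>
    measurable_const.indicator (measurableSet_norm_linComb_le hW (fourCoeff q) r)]
  refine Finset.sum_congr rfl fun q _ => ?_
  rw [lintegral_indicator_const (measurableSet_norm_linComb_le hW (fourCoeff q) r), one_mul]

theorem volume_closedBall_le (r : ℝ) :
    volume (Metric.closedBall (0 : UnitAddCircle) r) ≤ ENNReal.ofReal (2 * r) := by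
  rw [AddCircle.volume_closedBall]
  exact ENNReal.ofReal_le_ofReal (min_le_right _ _)

/-- A block of `q'` outside `blocks q` carries a uniform variable that occurs only in `q'`, making
the two hits independent. So only the `q'` with `blocks q' ⊆ blocks q` are correlated with `q`. -/
theorem integral_hitCount_sub_sq_le [IsProbabilityMeasure μ] (hind : iIndepFun W μ)
    (hW : ∀ i, Measurable (W i)) (hu : ∀ j, μ.map (W (Sum.inl j)) = volume) (N : ℕ) {r : ℝ}
    (hr : 0 ≤ r) :
    ∫ ω, (hitCount W (genericQuadruples N) r ω - (genericQuadruples N).card *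
        volume.real (Metric.closedBall (0 : UnitAddCircle) r)) ^ 2 ∂μ ≤
      (genericQuadruples N).card * ((4096 : ℕ) *
        volume.real (Metric.closedBall (0 : UnitAddCircle) r)) := by
  have hgen : ∀ q ∈ genericQuadruples N, μ {ω | ‖linComb W (fourCoeff q) ω‖ ≤ r} =
      volume (Metric.closedBall (0 : UnitAddCircle) r) := fun q hq =>
    measure_norm_linComb_eq hind hW (hu (q.1 / 2))
      ((Finset.mem_filter.1 hq).2.fourCoeff_ne_zero (by simp [blocks])) hr
  refine integral_sum_indicator_sub_sq_le (genericQuadruples N) _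
    (fun q => measurableSet_norm_linComb_le hW (fourCoeff q) r)
    (fun q hq => congrArg ENNReal.toReal (hgen q hq))
    (fun q => (quadruples N).filter fun q' => blocks q' ⊆ blocks q)
    (fun q _ => card_blocks_subset_le q N) fun q hq q' hq' hbad => ?_
  have hns : ¬ blocks q' ⊆ blocks q := fun h =>
    hbad (Finset.mem_filter.2 ⟨(Finset.mem_filter.1 hq').1, h⟩)
  obtain ⟨b, hb, hb'⟩ := Finset.not_subset.1 hns
  have h := measure_norm_linComb_le_inter hind hW (hu b)
    ((Finset.mem_filter.1 hq').2.fourCoeff_ne_zero hb) (fourCoeff_eq_zero_of_notMem hb') r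
  rw [hgen q hq] at h
  rw [Set.inter_comm, sq]
  exact (congrArg ENNReal.toReal h).trans ENNReal.toReal_mul

/-! ### Generic quadruples: the main term. -/

theorem ae_tendsto_hitCount_genericQuadruples [IsProbabilityMeasure μ] (hind : iIndepFun W μ)
    (hW : ∀ i, Measurable (W i)) (hu : ∀ j, μ.map (W (Sum.inl j)) = volume) {s : ℝ}
    (hs : 0 < s) :
    ∀ᵐ ω ∂μ, Tendsto (fun N : ℕ => hitCount W (genericQuadruples N) (s / (N : ℝ) ^ 2) ω /
      (N : ℝ) ^ 2) atTop (𝓝 (2 * s)) := by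
  set V : ℕ → ℝ := fun N =>
    volume.real (Metric.closedBall (0 : UnitAddCircle) (s / (N : ℝ) ^ 2)) with hV
  set M : ℕ → ℝ := fun N => (genericQuadruples N).card * V N with hM
  have hr : ∀ N : ℕ, 0 ≤ s / (N : ℝ) ^ 2 := fun N => by positivity
  have hVle : ∀ N, V N ≤ 2 * (s / (N : ℝ) ^ 2) := fun N =>
    ENNReal.toReal_le_of_le_ofReal (by have := hr N; positivity) (volume_closedBall_le _)
  have hmean : Tendsto (fun N : ℕ => M N / (N : ℝ) ^ 2) atTop (𝓝 (2 * s)) := by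
    have hinv : Tendsto (fun N : ℕ => (N : ℝ)⁻¹) atTop (𝓝 0) := tendsto_inv_atTop_nhds_zero_nat
    have hlow : Tendsto (fun N : ℕ => (1 - 12 * (N : ℝ)⁻¹) * (2 * s)) atTop (𝓝 (2 * s)) := by
      have := ((hinv.const_mul 12).const_sub 1).mul_const (2 * s)
      simpa using this
    -- The volume of a ball is `min 1 (2r)`, so it equals `2r` only once `2s ≤ N²`.
    have hVeq : ∀ᶠ N : ℕ in atTop, V N = 2 * (s / (N : ℝ) ^ 2) := by
      filter_upwards [eventually_ge_atTop (max 1 ⌈2 * s⌉₊)] with N hN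
      have h1 : (1 : ℝ) ≤ N := by exact_mod_cast (le_max_left _ _).trans hN
      have h2 : 2 * s ≤ N := Nat.ceil_le.1 ((le_max_right _ _).trans hN)
      have h3 : 2 * (s / (N : ℝ) ^ 2) ≤ 1 := by
        rw [← mul_div_assoc, div_le_one (by positivity)]
        nlinarith
      simp only [hV, Measure.real]
      rw [AddCircle.volume_closedBall, min_eq_right h3, ENNReal.toReal_ofReal]
      have := hr N
      positivity
    refine tendsto_of_tendsto_of_tendsto_of_le_of_le' hlow tendsto_const_nhds ?_ ?_
    · filter_upwards [hVeq, eventually_ge_atTop 1] with N hN h1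
      have hN0 : (0 : ℝ) < N := by exact_mod_cast h1
      have hc : (N : ℝ) ^ 4 ≤ (genericQuadruples N).card + 12 * (N : ℝ) ^ 3 := by
        exact_mod_cast le_card_genericQuadruples N
      simp only [hM]
      rw [hN]
      have e : ((genericQuadruples N).card : ℝ) * (2 * (s / (N : ℝ) ^ 2)) / (N : ℝ) ^ 2 =
        ((genericQuadruples N).card / (N : ℝ) ^ 4) * (2 * s) := by field_simp
      rw [e]
      refine mul_le_mul_of_nonneg_right ?_ (by positivity)
      rw [le_div_iff₀ (by positivity)]
      have : (1 - 12 * (N : ℝ)⁻¹) * (N : ℝ) ^ 4 = (N : ℝ) ^ 4 - 12 * (N : ℝ) ^ 3 := by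
        field_simp
      linarith
    · filter_upwards [hVeq, eventually_ge_atTop 1] with N hN h1
      have hN0 : (0 : ℝ) < N := by exact_mod_cast h1
      have hc : ((genericQuadruples N).card : ℝ) ≤ (N : ℝ) ^ 4 := by
        exact_mod_cast card_genericQuadruples_le N
      simp only [hM]
      rw [hN, div_le_iff₀ (by positivity)]
      calc ((genericQuadruples N).card : ℝ) * (2 * (s / (N : ℝ) ^ 2)) ≤
          (N : ℝ) ^ 4 * (2 * (s / (N : ℝ) ^ 2)) := by gcongr
        _ = 2 * s * (N : ℝ) ^ 2 := by field_simp
  have hdev : ∀ᵐ ω ∂μ, Tendsto (fun N : ℕ => ((hitCount W (genericQuadruples N)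
      (s / (N : ℝ) ^ 2) ω - M N) / (N : ℝ) ^ 2) ^ 2) atTop (𝓝 0) := by
    -- The second moment is at most `N⁴ · 4096 · 2s/N²`; division by `N⁴` leaves `8192 s/N²`. Being
    -- summable, this needs no subsequence.
    refine ae_tendsto_zero_of_summable_lintegral
      (fun N => (((measurable_hitCount hW _ _).sub_const _).div_const _).pow_const 2)
      (fun N ω => sq_nonneg _) (a := fun N : ℕ => 8192 * s * (1 / (N : ℝ) ^ 2))
      (fun N => by positivity)
      ((Real.summable_one_div_nat_pow.2 one_lt_two).mul_left _) fun N => ?_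
    have hbdd : ∀ ω, |hitCount W (genericQuadruples N) (s / (N : ℝ) ^ 2) ω| ≤
        (genericQuadruples N).card := by
      intro ω
      rw [abs_of_nonneg (hitCount_nonneg _ _ _), hitCount_eq_card]
      exact_mod_cast Finset.card_filter_le _ _
    have hintg : Integrable (fun ω => ((hitCount W (genericQuadruples N)
        (s / (N : ℝ) ^ 2) ω - M N) / (N : ℝ) ^ 2) ^ 2) μ := by
      refine Integrable.of_bound
        (((((measurable_hitCount hW _ _).sub_const _).div_const _).pow_const 2).aestronglyMeasurable)
        (((((genericQuadruples N).card : ℝ) + |M N|) / (N : ℝ) ^ 2) ^ 2) (ae_of_all _ fun ω => ?_)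
      rw [Real.norm_eq_abs, abs_pow, abs_div, abs_of_nonneg (sq_nonneg (N : ℝ))]
      gcongr
      exact (abs_sub _ _).trans (add_le_add (hbdd ω) le_rfl)
    rw [← ofReal_integral_eq_lintegral_ofReal hintg (ae_of_all _ fun ω => sq_nonneg _)]
    refine ENNReal.ofReal_le_ofReal ?_
    simp_rw [div_pow]
    rw [integral_div]
    have h := integral_hitCount_sub_sq_le hind hW hu N (hr N)
    rcases Nat.eq_zero_or_pos N with rfl | hpos
    · simp
    have hN0 : (0 : ℝ) < N := by exact_mod_cast hpos
    rw [div_le_iff₀ (by positivity)]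
    refine h.trans ?_
    have hc : ((genericQuadruples N).card : ℝ) ≤ (N : ℝ) ^ 4 := by
      exact_mod_cast card_genericQuadruples_le N
    have hv := hVle N
    calc ((genericQuadruples N).card : ℝ) * ((4096 : ℕ) * V N) ≤
        (N : ℝ) ^ 4 * ((4096 : ℕ) * (2 * (s / (N : ℝ) ^ 2))) := by gcongr
      _ = 8192 * s * (1 / (N : ℝ) ^ 2) * ((N : ℝ) ^ 2) ^ 2 := by
        push_cast; field_simp; ring
  filter_upwards [hdev] with ω hω
  have habs := (Real.continuous_sqrt.tendsto 0).comp hω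
  rw [Real.sqrt_zero] at habs
  have hz : Tendsto (fun N : ℕ => (hitCount W (genericQuadruples N)
      (s / (N : ℝ) ^ 2) ω - M N) / (N : ℝ) ^ 2) atTop (𝓝 0) := by
    rw [tendsto_zero_iff_abs_tendsto_zero]
    exact habs.congr fun N => Real.sqrt_sq_eq_abs _
  have := hz.add hmean
  rw [zero_add] at this
  exact this.congr fun N => by rw [← add_div, sub_add_cancel]

/-! ### Degenerate quadruples: the error term. -/

theorem lintegral_hitCount_degenerateQuadruples_le [IsProbabilityMeasure μ]
    (hind : iIndepFun W μ) (hW : ∀ i, Measurable (W i))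
    (hu : ∀ j, μ.map (W (Sum.inl j)) = volume) {N : ℕ} {K : ℝ} (hK0 : 0 ≤ K)
    (hK : ∀ i < N, μ.map (W (Sum.inr i)) ≤ ENNReal.ofReal K • volume) {r : ℝ} (hr : 0 ≤ r) :
    ∫⁻ ω, ENNReal.ofReal (hitCount W (degenerateQuadruples N) r ω) ∂μ ≤
      ENNReal.ofReal ((12 * (N : ℝ) ^ 3 + 16 * (N : ℝ) ^ 2 * K) * (2 * r)) := by
  classical
  rw [lintegral_hitCount hW]
  -- `Z` is full cancellation of the uniform variables: few quadruples, weaker probability bound.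
  -- Otherwise a uniform variable gives the bound `2r`.
  set Z : ℕ × ℕ × ℕ × ℕ → Prop := fun q => ∀ b, fourCoeff q (Sum.inl b) = 0 with hZ
  rw [← Finset.sum_filter_add_sum_filter_not (degenerateQuadruples N) Z]
  have h1 : ∑ q ∈ (degenerateQuadruples N).filter Z, μ {ω | ‖linComb W (fourCoeff q) ω‖ ≤ r} ≤
      ENNReal.ofReal (16 * (N : ℝ) ^ 2 * K * (2 * r)) := by
    refine (Finset.sum_le_card_nsmul _ _ (ENNReal.ofReal (K * (2 * r))) fun q hq => ?_).trans ?_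
    · obtain ⟨m, n, k, l⟩ := q
      have hd := (Finset.mem_filter.1 (Finset.mem_filter.1 hq).1)
      obtain ⟨i, hi, hne⟩ := exists_fourCoeff_inr_ne_zero hd.2.2 hd.1
      refine (measure_norm_linComb_le hind hW (hK i hi) hne r).trans ?_
      rw [ENNReal.ofReal_mul hK0]
      exact mul_le_mul_right (volume_closedBall_le r) _
    · have hc := card_fourCoeff_inl_eq_zero_le N ((degenerateQuadruples N).filter Z)
        ((Finset.filter_subset _ _).trans (Finset.filter_subset _ _))
        fun q hq => (Finset.mem_filter.1 hq).2
      rw [← ENNReal.ofReal_nsmul, nsmul_eq_mul, mul_assoc (16 * (N : ℝ) ^ 2)]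
      refine ENNReal.ofReal_le_ofReal (mul_le_mul_of_nonneg_right ?_ (by positivity))
      exact_mod_cast hc
  have h2 : ∑ q ∈ (degenerateQuadruples N).filter fun q => ¬ Z q,
      μ {ω | ‖linComb W (fourCoeff q) ω‖ ≤ r} ≤
      ENNReal.ofReal (12 * (N : ℝ) ^ 3 * (2 * r)) := by
    refine (Finset.sum_le_card_nsmul _ _ (ENNReal.ofReal (2 * r)) fun q hq => ?_).trans ?_
    · obtain ⟨b, hb⟩ := not_forall.1 (Finset.mem_filter.1 hq).2
      rw [measure_norm_linComb_eq hind hW (hu b) hb hr]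
      exact volume_closedBall_le r
    · have hc : ((degenerateQuadruples N).filter fun q => ¬ Z q).card ≤ 12 * N ^ 3 := by
        refine (Finset.card_le_card fun q hq => ?_).trans (card_not_blockDistinct_le N)
        have hd := Finset.mem_filter.1 (Finset.mem_filter.1 hq).1
        exact Finset.mem_filter.2 ⟨hd.1, hd.2.1⟩
      rw [← ENNReal.ofReal_nsmul, nsmul_eq_mul]
      refine ENNReal.ofReal_le_ofReal (mul_le_mul_of_nonneg_right ?_ (by positivity))
      exact_mod_cast hc
  refine (add_le_add h1 h2).trans (le_of_eq ?_)
  rw [← ENNReal.ofReal_add (by positivity) (by positivity)]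
  congr 1
  ring

/-- The normalised first moment is only bounded by `O(N^(-1/2))`, which is not summable. It is
summable along `N = 4^k`, and monotonicity of the count in the index range and the radius fills the
gaps. Powers of 4 make `(4^k)^(3/2) = 8^k`. -/
theorem ae_tendsto_hitCount_degenerateQuadruples [IsProbabilityMeasure μ]
    (hind : iIndepFun W μ) (hW : ∀ i, Measurable (W i))
    (hu : ∀ j, μ.map (W (Sum.inl j)) = volume)
    (hK : ∀ i : ℕ, μ.map (W (Sum.inr i)) ≤
      ENNReal.ofReal (2 * ((i : ℝ) + 1) ^ (3 / 2 : ℝ)) • volume) {s : ℝ} (hs : 0 < s) :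
    ∀ᵐ ω ∂μ, Tendsto (fun N : ℕ => hitCount W (degenerateQuadruples N) (s / (N : ℝ) ^ 2) ω /
      (N : ℝ) ^ 2) atTop (𝓝 0) := by
  have h8 : ∀ k : ℕ, ((4 : ℝ) ^ k) ^ (3 / 2 : ℝ) = 8 ^ k := by
    intro k
    rw [← Real.rpow_natCast, ← Real.rpow_mul (by norm_num), mul_comm, Real.rpow_mul (by norm_num),
      Real.rpow_natCast, show (4 : ℝ) = 2 ^ (2 : ℝ) by norm_num, ← Real.rpow_mul (by norm_num)]
    norm_num
  -- The radius is enlarged by 16 so that it dominates `s/N²` whenever `4^k ≤ 4N`.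
  have hsub : ∀ᵐ ω ∂μ, Tendsto (fun k : ℕ => hitCount W (degenerateQuadruples (4 ^ k))
      (16 * s / ((4 : ℝ) ^ k) ^ 2) ω / ((4 : ℝ) ^ k) ^ 2) atTop (𝓝 0) := by
    refine ae_tendsto_zero_of_summable_lintegral
      (fun k => (measurable_hitCount hW _ _).div_const _)
      (fun k ω => div_nonneg (hitCount_nonneg _ _ _) (by positivity))
      -- `1408 = 12·2·16 + 16·2·2·16`, from the two terms of the first moment bound.
      (a := fun k : ℕ => 1408 * s * (1 / 2 : ℝ) ^ k) (fun k => by positivity)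
      (summable_geometric_two.mul_left _) fun k => ?_
    have hr : 0 ≤ 16 * s / ((4 : ℝ) ^ k) ^ 2 := by positivity
    have h := lintegral_hitCount_degenerateQuadruples_le (μ := μ) hind hW hu (N := 4 ^ k)
      (K := 2 * 8 ^ k) (by positivity) (fun i hi => (hK i).trans ?_) hr
    · have hdiv : ∀ ω, ENNReal.ofReal (hitCount W (degenerateQuadruples (4 ^ k))
          (16 * s / ((4 : ℝ) ^ k) ^ 2) ω / ((4 : ℝ) ^ k) ^ 2) =
          ENNReal.ofReal ((((4 : ℝ) ^ k) ^ 2)⁻¹) * ENNReal.ofReal (hitCount W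
          (degenerateQuadruples (4 ^ k)) (16 * s / ((4 : ℝ) ^ k) ^ 2) ω) := fun ω => by
        rw [← ENNReal.ofReal_mul (by positivity), div_eq_inv_mul]
      simp_rw [hdiv]
      rw [lintegral_const_mul _ (measurable_hitCount hW _ _).ennreal_ofReal]
      refine (mul_le_mul_right h _).trans ?_
      rw [← ENNReal.ofReal_mul (by positivity)]
      refine ENNReal.ofReal_le_ofReal ?_
      push_cast
      have e2 : (8 : ℝ) ^ k = 4 ^ k * 2 ^ k := by rw [← mul_pow]; norm_num
      have e3 : (4 : ℝ) ^ k = 2 ^ k * 2 ^ k := by rw [← mul_pow]; norm_num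
      have e4 : (1 : ℝ) ≤ 2 ^ k := one_le_pow₀ one_le_two
      rw [e2, e3, div_pow, one_pow]
      set u : ℝ := 2 ^ k
      have hu0 : 0 < u := by linarith
      have : ((u * u) ^ 2)⁻¹ * ((12 * (u * u) ^ 3 + 16 * (u * u) ^ 2 * (2 * (u * u * u))) *
          (2 * (16 * s / (u * u) ^ 2))) = 384 * s / (u * u) + 1024 * s / u := by
        field_simp; ring
      rw [this]
      have h5 : 384 * s / (u * u) ≤ 384 * s / u := by
        gcongr
        nlinarith
      calc 384 * s / (u * u) + 1024 * s / u ≤ 384 * s / u + 1024 * s / u := by gcongr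
        _ = 1408 * s * (1 / u) := by ring
    · refine Measure.le_iff'.2 fun A => ?_
      simp only [Measure.smul_apply, smul_eq_mul]
      refine mul_le_mul_left (ENNReal.ofReal_le_ofReal ?_) _
      rw [← h8]
      gcongr
      exact_mod_cast hi
  filter_upwards [hsub] with ω hω
  have hlog : Tendsto (fun N : ℕ => Nat.log 4 N + 1) atTop atTop := by
    refine tendsto_atTop_mono (fun N => Nat.le_succ _) ?_
    refine tendsto_atTop.2 fun k => ?_
    filter_upwards [eventually_ge_atTop (4 ^ k)] with N hN
    exact Nat.le_log_of_pow_le (by norm_num) hN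
  -- This 16 pays for replacing the denominator `(4^k)²` by `N²`.
  have hcomp := (hω.comp hlog).const_mul 16
  rw [mul_zero] at hcomp
  refine tendsto_of_tendsto_of_tendsto_of_le_of_le' tendsto_const_nhds hcomp
    (Eventually.of_forall fun N => div_nonneg (hitCount_nonneg _ _ _) (by positivity)) ?_
  filter_upwards [eventually_ge_atTop 1] with N hN
  simp only [Function.comp_apply]
  set k := Nat.log 4 N + 1
  have hlt : N < 4 ^ k := Nat.lt_pow_succ_log_self (by norm_num) N
  have hle : 4 ^ k ≤ 4 * N := by
    rw [pow_succ, mul_comm]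
    exact Nat.mul_le_mul_left 4 (Nat.pow_log_le_self 4 (by omega))
  have hN0 : (0 : ℝ) < N := by exact_mod_cast hN
  have hle' : (4 : ℝ) ^ k ≤ 4 * N := by exact_mod_cast hle
  have hsq : ((4 : ℝ) ^ k) ^ 2 ≤ 16 * (N : ℝ) ^ 2 := by
    calc ((4 : ℝ) ^ k) ^ 2 ≤ (4 * (N : ℝ)) ^ 2 := by gcongr
      _ = 16 * (N : ℝ) ^ 2 := by ring
  have hrad : s / (N : ℝ) ^ 2 ≤ 16 * s / ((4 : ℝ) ^ k) ^ 2 := by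
    rw [div_le_div_iff₀ (by positivity) (by positivity)]
    nlinarith
  have hh := hitCount_mono (W := W) (degenerateQuadruples_mono hlt.le) hrad ω
  rw [← mul_div_assoc, div_le_div_iff₀ (by positivity) (by positivity)]
  have h0 := hitCount_nonneg (W := W) (degenerateQuadruples N) (s / (N : ℝ) ^ 2) ω
  calc _ ≤ hitCount W (degenerateQuadruples (4 ^ k)) (16 * s / ((4 : ℝ) ^ k) ^ 2) ω *
        (16 * (N : ℝ) ^ 2) := by gcongr; exact h0.trans hh
    _ = _ := by ring

end HitCount

/-! ### Reduction of the four-fold count to hit counts and to rational `s`. -/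

theorem fourFoldCount_eq_hitCount {Ω : Type*} {W : ℕ ⊕ ℕ → Ω → UnitAddCircle}
    {y : ℕ → UnitAddCircle} {ω : Ω}
    (hy : ∀ i, y (i + 1) = W (Sum.inl (i / 2)) ω + W (Sum.inr i) ω) (N : ℕ) (r : ℝ) :
    (fourFoldCount y N r : ℝ) =
      hitCount W (genericQuadruples N) r ω + hitCount W (degenerateQuadruples N) r ω := by
  classical
  have hdisj : Disjoint (genericQuadruples N) (degenerateQuadruples N) := by
    rw [Finset.disjoint_left]
    intro q h1 h2
    exact (Finset.mem_filter.1 h2).2.1 (Finset.mem_filter.1 h1).2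
  have hsum : hitCount W (genericQuadruples N) r ω + hitCount W (degenerateQuadruples N) r ω =
      hitCount W (genericQuadruples N ∪ degenerateQuadruples N) r ω := by
    unfold hitCount
    rw [Finset.sum_union hdisj]
  have hunion : genericQuadruples N ∪ degenerateQuadruples N =
      (quadruples N).filter fun q => ({q.1, q.2.1} : Finset ℕ) ≠ {q.2.2.1, q.2.2.2} := by
    ext q
    simp only [genericQuadruples, degenerateQuadruples, Finset.mem_union, Finset.mem_filter]
    have := BlockDistinct.pair_ne (m := q.1) (n := q.2.1) (k := q.2.2.1) (l := q.2.2.2)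
    tauto
  rw [hsum, hunion, hitCount_eq_card, Finset.filter_filter, fourFoldCount]
  congr 1
  symm
  set φ : ℕ × ℕ × ℕ × ℕ → ℕ × ℕ × ℕ × ℕ :=
    fun q => (q.1 + 1, q.2.1 + 1, q.2.2.1 + 1, q.2.2.2 + 1) with hφ
  have hpair : ∀ m n k l : ℕ, ({m + 1, n + 1} : Finset ℕ) = {k + 1, l + 1} ↔
      ({m, n} : Finset ℕ) = {k, l} := by
    intro m n k l
    have h := Finset.map_inj (f := addRightEmbedding 1) (s₁ := ({m, n} : Finset ℕ)) (s₂ := {k, l})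
    simpa [Finset.map_insert] using h
  refine Finset.card_bij (fun q _ => φ q) ?_ ?_ ?_
  · rintro ⟨m, n, k, l⟩ hq
    simp only [quadruples, Finset.mem_filter, Finset.mem_product, Finset.mem_range,
      linComb_fourCoeff] at hq
    simp only [hφ, Finset.mem_filter, Finset.mem_product, Finset.mem_Icc, hy, ne_eq, hpair]
    exact ⟨by omega, hq.2⟩
  · rintro ⟨m, n, k, l⟩ _ ⟨m', n', k', l'⟩ _ h
    simpa [hφ] using h
  · rintro ⟨m, n, k, l⟩ hq
    simp only [Finset.mem_filter, Finset.mem_product, Finset.mem_Icc] at hq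
    obtain ⟨⟨hm, hn, hk, hl⟩, hne, hle⟩ := hq
    obtain ⟨m, rfl⟩ : ∃ i, m = i + 1 := ⟨m - 1, by omega⟩
    obtain ⟨n, rfl⟩ : ∃ i, n = i + 1 := ⟨n - 1, by omega⟩
    obtain ⟨k, rfl⟩ : ∃ i, k = i + 1 := ⟨k - 1, by omega⟩
    obtain ⟨l, rfl⟩ : ∃ i, l = i + 1 := ⟨l - 1, by omega⟩
    refine ⟨(m, n, k, l), ?_, rfl⟩
    simp only [ne_eq, hpair, hy] at hne hle
    simp only [quadruples, Finset.mem_filter, Finset.mem_product, Finset.mem_range,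
      linComb_fourCoeff]
    exact ⟨by omega, hne, hle⟩

theorem fourFoldCount_mono (y : ℕ → UnitAddCircle) (N : ℕ) {r r' : ℝ} (h : r ≤ r') :
    fourFoldCount y N r ≤ fourFoldCount y N r' :=
  Finset.card_le_card (Finset.monotone_filter_right _ fun _ _ hq => ⟨hq.1, hq.2.trans h⟩)

/-- It suffices to check Poissonian correlation of four-fold differences for rational `s`. -/
theorem poissonianFourFoldCorrelation_of_rat {y : ℕ → UnitAddCircle}
    (h : ∀ q : ℚ, 0 < q → Tendsto
      (fun N : ℕ => (fourFoldCount y N ((q : ℝ) / (N : ℝ) ^ 2) : ℝ) / (N : ℝ) ^ 2)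
      atTop (𝓝 (2 * (q : ℝ)))) : PoissonianFourFoldCorrelation y := by
  intro s hs
  have hmono : ∀ {a b : ℝ}, a ≤ b → ∀ N : ℕ,
      (fourFoldCount y N (a / (N : ℝ) ^ 2) : ℝ) / (N : ℝ) ^ 2 ≤
        (fourFoldCount y N (b / (N : ℝ) ^ 2) : ℝ) / (N : ℝ) ^ 2 := by
    intro a b hab N
    gcongr
    exact fourFoldCount_mono y N (by gcongr)
  refine tendsto_order.2 ⟨fun a ha => ?_, fun a ha => ?_⟩
  -- Counts increase with `s` and the limit `2s` is continuous, so nearby rationals sandwich; the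
  -- `max` keeps `q` positive.
  · obtain ⟨q, hq1, hq2⟩ := exists_rat_btwn (show max (a / 2) 0 < s from max_lt (by linarith) hs)
    have hq0 : (0 : ℝ) < q := (le_max_right _ _).trans_lt hq1
    have hqa : a < 2 * q := by linarith [(le_max_left (a / 2) 0).trans_lt hq1]
    filter_upwards [(h q (by exact_mod_cast hq0)).eventually_const_lt hqa] with N hN
    exact hN.trans_le (hmono hq2.le N)
  · obtain ⟨q, hq1, hq2⟩ := exists_rat_btwn (show s < a / 2 by linarith)
    have hq0 : (0 : ℝ) < q := hs.trans hq1
    filter_upwards [(h q (by exact_mod_cast hq0)).eventually_lt_const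
      (show 2 * (q : ℝ) < a by linarith)] with N hN
    exact (hmono hq1.le N).trans_lt hN

/-! ### Failure of pair correlation. -/

/-- A sequence whose points `2 j + 1` and `2 j + 2` have distance `O(j ^ (-3 / 2))` does not have
Poissonian pair correlation. -/
theorem not_poissonianPairCorrelation_of_norm_sub_le {y : ℕ → UnitAddCircle}
    (hy : ∀ j : ℕ, ‖y (2 * j + 1) - y (2 * j + 2)‖ ≤ 2 * ((2 * j + 1 : ℕ) : ℝ) ^ (-(3 / 2) : ℝ)) :
    ¬ PoissonianPairCorrelation y := by
  intro hP
  -- The limit would be `1/2`, but at `N = 8t` at least `6t` ordered pairs are counted, a ratio of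
  -- `3/4`.
  have h := hP (1 / 4) (by norm_num)
  have h8 : Tendsto (fun t : ℕ => 8 * t) atTop atTop :=
    tendsto_id.const_mul_atTop' (by norm_num)
  have h' := h.comp h8
  have hlt := h'.eventually_lt_const (show (2 * (1 / 4) : ℝ) < 3 / 4 by norm_num)
  -- `t ≥ 512` gives `2j+1 ≥ 1024 = 32²`, hence `(2j+1)^(3/2) ≥ 64t` and a distance of at most
  -- `1/(32t) = (1/4)/(8t)`.
  obtain ⟨t, hlt, ht⟩ := (hlt.and (eventually_ge_atTop 512)).exists
  simp only [Function.comp_apply] at hlt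
  have ht0 : (512 : ℝ) ≤ t := by exact_mod_cast ht
  have hclose : ∀ j, t ≤ j →
      ‖y (2 * j + 1) - y (2 * j + 2)‖ ≤ 1 / 4 / ((8 * t : ℕ) : ℝ) := by
    intro j hj
    refine (hy j).trans ?_
    have hj' : (t : ℝ) ≤ j := by exact_mod_cast hj
    have hb : (64 * t : ℝ) ≤ ((2 * j + 1 : ℕ) : ℝ) ^ (3 / 2 : ℝ) := by
      have hx : (0 : ℝ) < ((2 * j + 1 : ℕ) : ℝ) := by positivity
      have hx1 : (2 * t : ℝ) ≤ ((2 * j + 1 : ℕ) : ℝ) := by push_cast; linarith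
      rw [show (3 / 2 : ℝ) = 1 + 1 / 2 by norm_num, Real.rpow_add hx, Real.rpow_one,
        ← Real.sqrt_eq_rpow]
      have hs : (32 : ℝ) ≤ √((2 * j + 1 : ℕ) : ℝ) := by
        refine Real.le_sqrt_of_sq_le ?_
        linarith
      nlinarith
    rw [Real.rpow_neg (by positivity)]
    push_cast at hb ⊢
    have : ((2 * (j : ℝ) + 1) ^ (3 / 2 : ℝ))⁻¹ ≤ (64 * (t : ℝ))⁻¹ :=
      inv_anti₀ (by positivity) hb
    calc 2 * ((2 * (j : ℝ) + 1) ^ (3 / 2 : ℝ))⁻¹ ≤ 2 * (64 * (t : ℝ))⁻¹ := by gcongr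
      _ = 1 / 4 / (8 * (t : ℝ)) := by field_simp; norm_num
  have hcount : 6 * t ≤ pairCount y (8 * t) (1 / 4 / ((8 * t : ℕ) : ℝ)) := by
    -- The bit chooses the order within the pair; `j < 4t` keeps `2j+2 ≤ 8t`.
    have e : (Finset.Ico t (4 * t) ×ˢ Finset.range 2).card = 6 * t := by
      simp only [Finset.card_product, Nat.card_Ico, Finset.card_range]; omega
    rw [← e]
    refine Finset.card_le_card_of_injOn
      (fun v => (2 * v.1 + 1 + v.2, 2 * v.1 + 2 - v.2)) ?_ ?_
    · rintro ⟨j, e⟩ hv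
      simp only [Finset.coe_product, Set.mem_prod, Finset.mem_coe, Finset.mem_Ico,
        Finset.mem_range] at hv
      obtain ⟨⟨hj1, hj2⟩, he⟩ := hv
      simp only [Finset.coe_filter, Set.mem_ofPred_eq, Finset.mem_product, Finset.mem_Icc]
      refine ⟨by omega, by omega, ?_⟩
      have hc := hclose j hj1
      interval_cases e
      · exact hc
      · rw [norm_sub_rev] at hc
        exact hc
    · rintro ⟨j, e⟩ hv ⟨j', e'⟩ hv' heq
      simp only [Finset.coe_product, Set.mem_prod, Finset.mem_coe, Finset.mem_Ico,
        Finset.mem_range] at hv hv'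
      simp only [Prod.mk.injEq] at heq ⊢
      omega
  have hcount' : (6 * t : ℝ) ≤ pairCount y (8 * t) (1 / 4 / ((8 * t : ℕ) : ℝ)) := by
    exact_mod_cast hcount
  rw [div_lt_iff₀ (by push_cast; linarith)] at hlt
  push_cast at hlt hcount'
  linarith

/-! ### Assembly. -/

theorem ae_mem_of_isUniform {Ω : Type*} [MeasurableSpace Ω] {μ : Measure Ω} {p : Ω → ℝ}
    (hp : Measurable p) {s : Set ℝ} (hs : MeasurableSet s)
    (hu : pdf.IsUniform p s μ volume) : ∀ᵐ ω ∂μ, p ω ∈ s := by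
  have h : ∀ᵐ t ∂(μ.map p), t ∈ s := by
    rw [hu]
    exact ae_cond_mem hs
  exact ae_of_ae_map hp.aemeasurable h

theorem mainTheorem9 {Ω : Type*} [MeasurableSpace Ω] (μ : MeasureTheory.Measure Ω)
    [MeasureTheory.IsProbabilityMeasure μ]
    (x : ℕ → Ω → UnitAddCircle) (p : ℕ → Ω → ℝ)
    (hx_meas : ∀ n : ℕ, 1 ≤ n → Measurable (x n))
    (hp_meas : ∀ n : ℕ, 1 ≤ n → Measurable (p n))
    -- `x 1, x 3, x 5, …` are uniform on the circle
    (hx_unif : ∀ j : ℕ,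
      MeasureTheory.pdf.IsUniform (x (2 * j + 1)) Set.univ μ MeasureTheory.volume)
    -- each of these points is repeated once
    (hx_dup : ∀ j : ℕ, x (2 * j + 2) = x (2 * j + 1))
    -- the perturbation `p n` is uniform on `[-n ^ (-3/2), n ^ (-3/2)]`
    (hp_unif : ∀ n : ℕ, 1 ≤ n →
      MeasureTheory.pdf.IsUniform (p n)
        (Set.Icc (-((n : ℝ) ^ (-(3 / 2) : ℝ))) ((n : ℝ) ^ (-(3 / 2) : ℝ)))
        μ MeasureTheory.volume)
    -- all of `x 1, x 3, x 5, …, p 1, p 2, p 3, …` are mutually independent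
    (hx_indep : ProbabilityTheory.iIndepFun (fun j : ℕ => x (2 * j + 1)) μ)
    (hp_indep : ProbabilityTheory.iIndepFun (fun n : ℕ => p (n + 1)) μ)
    (hxp_indep : ProbabilityTheory.IndepFun
      (fun (ω : Ω) (j : ℕ) => x (2 * j + 1) ω) (fun (ω : Ω) (n : ℕ) => p (n + 1) ω) μ) :
    ∀ᵐ ω ∂μ,
      ¬ PoissonianPairCorrelation (fun n : ℕ => x n ω + ((p n ω : ℝ) : UnitAddCircle)) ∧
        PoissonianFourFoldCorrelation (fun n : ℕ => x n ω + ((p n ω : ℝ) : UnitAddCircle)) := by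
  have hmk : Measurable ((↑) : ℝ → UnitAddCircle) := AddCircle.measurable_mk'
  -- Reducing the perturbations modulo one gives both families the same codomain, so they join into
  -- one independent family.
  set P : ℕ → Ω → UnitAddCircle := fun n ω => (p (n + 1) ω : UnitAddCircle) with hP
  set W : ℕ ⊕ ℕ → Ω → UnitAddCircle := Sum.elim (fun j => x (2 * j + 1)) P with hWdef
  have hW : ∀ i, Measurable (W i) := by
    rintro (j | n)
    · exact hx_meas _ (by omega)
    · exact hmk.comp (hp_meas _ (by omega))
  have hPind : iIndepFun P μ := hp_indep.comp (fun _ => ((↑) : ℝ → UnitAddCircle)) fun _ => hmk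
  have hmkpi : Measurable fun (v : ℕ → ℝ) (n : ℕ) => (v n : UnitAddCircle) :=
    measurable_pi_lambda _ fun n => hmk.comp (measurable_pi_apply n)
  have hind : iIndepFun W μ :=
    iIndepFun_sumElim hx_indep hPind (hxp_indep.comp measurable_id hmkpi)
  have hu : ∀ j, μ.map (W (Sum.inl j)) = volume := fun j => by
    have h := hx_unif j
    rw [pdf.IsUniform, ProbabilityTheory.cond, Measure.restrict_univ, UnitAddCircle.measure_univ,
      inv_one, one_smul] at h
    exact h
  have hK : ∀ i : ℕ, μ.map (W (Sum.inr i)) ≤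
      ENNReal.ofReal (2 * ((i : ℝ) + 1) ^ (3 / 2 : ℝ)) • volume := by
    intro i
    have hpos : (0 : ℝ) < ((i + 1 : ℕ) : ℝ) := by positivity
    have h := map_coe_le_of_isUniform (hp_meas (i + 1) (by omega)) (Real.rpow_pos_of_pos hpos _)
      (Real.rpow_le_one_of_one_le_of_nonpos (by push_cast; linarith [i.cast_nonneg (α := ℝ)])
        (by norm_num)) (hp_unif (i + 1) (by omega))
    rw [Real.rpow_neg hpos.le, inv_inv] at h
    push_cast at h
    exact h
  have hrange : ∀ᵐ ω ∂μ, ∀ i : ℕ, p (i + 1) ω ∈ Set.Icc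
      (-(((i + 1 : ℕ) : ℝ) ^ (-(3 / 2) : ℝ))) (((i + 1 : ℕ) : ℝ) ^ (-(3 / 2) : ℝ)) :=
    ae_all_iff.2 fun i =>
      ae_mem_of_isUniform (hp_meas _ (by omega)) measurableSet_Icc (hp_unif (i + 1) (by omega))
  -- Rational parameters keep the union of exceptional null sets countable.
  have hgen : ∀ᵐ ω ∂μ, ∀ q : {q : ℚ // 0 < q}, Tendsto (fun N : ℕ =>
      hitCount W (genericQuadruples N) (((q : ℚ) : ℝ) / (N : ℝ) ^ 2) ω / (N : ℝ) ^ 2) atTop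
      (𝓝 (2 * ((q : ℚ) : ℝ))) :=
    ae_all_iff.2 fun q =>
      ae_tendsto_hitCount_genericQuadruples hind hW hu (by exact_mod_cast q.2)
  have hdeg : ∀ᵐ ω ∂μ, ∀ q : {q : ℚ // 0 < q}, Tendsto (fun N : ℕ =>
      hitCount W (degenerateQuadruples N) (((q : ℚ) : ℝ) / (N : ℝ) ^ 2) ω / (N : ℝ) ^ 2) atTop
      (𝓝 0) :=
    ae_all_iff.2 fun q =>
      ae_tendsto_hitCount_degenerateQuadruples hind hW hu hK (by exact_mod_cast q.2)
  filter_upwards [hrange, hgen, hdeg] with ω h1 h2 h3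
  constructor
  · refine not_poissonianPairCorrelation_of_norm_sub_le fun j => ?_
    have ha := abs_le.2 (h1 (2 * j))
    have hb := abs_le.2 (h1 (2 * j + 1))
    have hb' : |p (2 * j + 2) ω| ≤ ((2 * j + 1 : ℕ) : ℝ) ^ (-(3 / 2) : ℝ) := by
      refine hb.trans (Real.rpow_le_rpow_of_nonpos (by positivity) ?_ (by norm_num))
      push_cast; linarith
    have e : x (2 * j + 1) ω + (p (2 * j + 1) ω : UnitAddCircle) -
        (x (2 * j + 2) ω + (p (2 * j + 2) ω : UnitAddCircle)) =
        (p (2 * j + 1) ω : UnitAddCircle) - (p (2 * j + 2) ω : UnitAddCircle) := by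
      rw [hx_dup]; abel
    have hnorm : ∀ t : ℝ, ‖(t : UnitAddCircle)‖ ≤ |t| := fun t =>
      QuotientAddGroup.norm_mk_le_norm
    rw [e]
    calc _ ≤ ‖(p (2 * j + 1) ω : UnitAddCircle)‖ + ‖(p (2 * j + 2) ω : UnitAddCircle)‖ :=
          norm_sub_le _ _
      _ ≤ |p (2 * j + 1) ω| + |p (2 * j + 2) ω| := add_le_add (hnorm _) (hnorm _)
      _ ≤ _ := by linarith
  · refine poissonianFourFoldCorrelation_of_rat fun q hq => ?_
    have hy : ∀ i, x (i + 1) ω + ((p (i + 1) ω : ℝ) : UnitAddCircle) =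
        W (Sum.inl (i / 2)) ω + W (Sum.inr i) ω := by
      intro i
      have hx : x (i + 1) = x (2 * (i / 2) + 1) := by
        rcases Nat.mod_two_eq_zero_or_one i with h | h
        · rw [show 2 * (i / 2) = i by omega]
        · rw [← hx_dup, show 2 * (i / 2) + 2 = i + 1 by omega]
      rw [hx]; rfl
    have h := (h2 ⟨q, hq⟩).add (h3 ⟨q, hq⟩)
    rw [add_zero] at h
    refine h.congr fun N => ?_
    rw [fourFoldCount_eq_hitCount hy, add_div]
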